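/- Let $n\ge 1$ be an integer and let $a_1,\ldots,a_n$ be arbitrary positive real numbers such that $\sum_{i=1}^n p_i=1$, where $p_i=e^{-a_i}$. For $\mathbf{x}=(x_1,\ldots,x_n)\in\mathbb{R}^n$ with nonnegative entries put \[ M(\mathbf{x})=\frac{\Gamma(x_1+\cdots+x_n+1)}{\Gamma(x_1+1)\cdots\Gamma(x_n+1)}, \] and for real $z$ let $S(z)=\{\mathbf{x}\in\mathbb{R}^n : x_i\ge 0 \text{ for all } i,\ \sum_{i=1}^n a_i x_i\le z\}$ and \[ f(z)=\int_{S(z)} M(\mathbf{x})\,dx_1\cdots dx_n . \] Then \[ \lim_{z\to\infty}\frac{f(z)}{e^{z}}=\frac{1}{H(\mathbf{p})},\qquad\text{where } H(\mathbf{p})=\sum_{i=1}^n a_i p_i . \] -/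

import Mathlib

open Filter Topology MeasureTheory

/-- The multinomial coefficient `(x₁ + ⋯ + xₙ)! / (x₁! ⋯ xₙ!)` extended to real arguments by
replacing `t!` with `Γ(t + 1)`; it is only used for vectors with nonnegative entries. -/
noncomputable def multinomialReal {n : ℕ} (x : Fin n → ℝ) : ℝ :=
  Real.Gamma ((∑ i, x i) + 1) / ∏ i, Real.Gamma (x i + 1)

/-- The simplex `S(z) = {x : x ≥ 0, a₁ x₁ + ⋯ + aₙ xₙ ≤ z}`. -/
def weightedSimplex {n : ℕ} (a : Fin n → ℝ) (z : ℝ) : Set (Fin n → ℝ) :=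
  {x | (∀ i, 0 ≤ x i) ∧ ∑ i, a i * x i ≤ z}

/-- The integral `f(z)` of the extended multinomial coefficient over `S(z)`, with respect to
the Lebesgue measure `dx₁ ⋯ dxₙ`. -/
noncomputable def simplexIntegral {n : ℕ} (a : Fin n → ℝ) (z : ℝ) : ℝ :=
  ∫ x in weightedSimplex a z, multinomialReal x

/-!
The normalised integral `h(z) = f(z) exp (-z)` is shown to converge by a Tauberian argument: its
Laplace transform at `ε` is computed and seen to be asymptotic to `1 / (ε H)` as `ε → 0⁺`, and `h`
satisfies a growth bound that turns this averaged statement into convergence.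

Everything rests on the continuous Poisson weights `π(x; y) = exp (-y) y ^ x / Γ (x + 1)`. Writing
`Γ (∑ xᵢ + 1)` as Euler's integral gives, because `∑ pᵢ = 1`,
`M(x) exp (-∑ aᵢ xᵢ) = ∫₀^∞ ∏ π(xᵢ; pᵢ u) du` (`multinomialReal_mul_prod_rpow`).

*Growth.* Convexity of `log Γ` gives `π(r x; r y) ≤ π(x; y)` for `r ≥ 1`
(`exp_neg_mul_rpow_div_Gamma_scale`). Inserted in the mixture it yields
`M(r x) exp (-r ∑ aᵢ xᵢ) ≤ r M(x) exp (-∑ aᵢ xᵢ)`, and dilating the simplex then gives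
`h(r z) ≤ r ^ (n + 1) h(z)` (`simplexIntegral_div_exp_scale`).

*Laplace transform.* By Tonelli the transform of `h` is a one-dimensional integral of products of
Volterra functions `ν(y) = ∫₀^∞ y ^ x / Γ (x + 1) dx` (`lintegral_laplace_simplexIntegral`). Since
`ν(y) ∼ exp y`, dominated convergence shows that it behaves like `1 / (1 - ∑ exp (-(1 + ε) aᵢ))`,
hence like `1 / (ε H)` (`tendsto_laplace_simplexIntegral`).

The same Tauberian theorem (`tendsto_of_tendsto_laplace`) serves twice: for `h`, and for
`exp (-y) ν(y)`, whose Laplace transform `1 / ((1 + ε) log (1 + ε))` is explicit.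
-/

/-! ### A Tauberian theorem for functions of bounded relative growth -/

section Tauberian

open Real Set

variable {h : ℝ → ℝ} {L : ℝ}

theorem integrableOn_exp_neg_mul_const (C ε : ℝ) (hε : 0 < ε) :
    IntegrableOn (fun z => exp (-(ε * z)) * C) (Ioi 0) := by
  have := (integrableOn_exp_mul_Ioi (a := -ε) (by linarith) 0).mul_const C
  simp only [neg_mul] at this
  exact this

/-- The hypothesis on the Laplace transform near `0`, read as a statement about the dilations
`w ↦ h (T w)` for large `T`: their Laplace transforms converge to that of the constant `L`. -/
theorem tendsto_laplace_dilation
    (hlim : Tendsto (fun ε : ℝ => ε * ∫ z in Ioi 0, exp (-(ε * z)) * h z) (𝓝[>] 0) (𝓝 L))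
    {c : ℝ} (hc : 0 < c) :
    Tendsto (fun T : ℝ => ∫ w in Ioi 0, exp (-(c * w)) * h (T * w)) atTop (𝓝 (L / c)) := by
  have h1 : Tendsto (fun T : ℝ => c / T) atTop (𝓝[>] 0) := by
    refine tendsto_nhdsWithin_iff.2 ⟨tendsto_const_nhds.div_atTop tendsto_id, ?_⟩
    filter_upwards [eventually_gt_atTop 0] with T hT using div_pos hc hT
  refine ((hlim.comp h1).div_const c).congr' ?_
  filter_upwards [eventually_gt_atTop 0] with T hT
  have := integral_comp_mul_left_Ioi (fun z => exp (-(c / T * z)) * h z) 0 hT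
  simp only [mul_zero, smul_eq_mul] at this
  simp only [Function.comp]
  have e : ∀ w, exp (-(c * w)) = exp (-(c / T * (T * w))) := fun w => by
    congr 2; field_simp
  simp_rw [e, this]
  field_simp

theorem integrableOn_laplace_dilation
    (hint : ∀ ε : ℝ, 0 < ε → IntegrableOn (fun z => exp (-(ε * z)) * h z) (Ioi 0))
    {q : ℝ → ℝ} (hq : Continuous q) {T : ℝ} (hT : 0 < T) :
    IntegrableOn (fun w => q (exp (-w)) * (exp (-w) * h (T * w))) (Ioi 0) := by
  obtain ⟨C, hC⟩ := (isCompact_Icc (a := (0 : ℝ)) (b := 1)).exists_bound_of_continuousOn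
    hq.continuousOn
  have h1 : IntegrableOn (fun w => exp (-w) * h (T * w)) (Ioi 0) := by
    have := (integrableOn_Ioi_comp_mul_left_iff
      (fun z => exp (-(1 / T * z)) * h z) 0 hT).2 (by simpa using hint (1 / T) (by positivity))
    refine this.congr_fun (fun w _ => ?_) measurableSet_Ioi
    simp only
    congr 3; field_simp
  refine h1.bdd_mul (c := C) (by fun_prop) ?_
  filter_upwards [ae_restrict_mem measurableSet_Ioi] with w hw
  exact hC _ ⟨(exp_pos _).le, exp_le_one_iff.2 (by simpa using le_of_lt hw)⟩

/-- Karamata's device: the powers of `exp (-w)` are again exponentials, so the convergence of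
Laplace transforms extends by linearity to polynomials in `exp (-w)`. -/
theorem tendsto_integral_polynomial_dilation
    (hint : ∀ ε : ℝ, 0 < ε → IntegrableOn (fun z => exp (-(ε * z)) * h z) (Ioi 0))
    (hlim : Tendsto (fun ε : ℝ => ε * ∫ z in Ioi 0, exp (-(ε * z)) * h z) (𝓝[>] 0) (𝓝 L))
    (P : Polynomial ℝ) :
    Tendsto (fun T : ℝ => ∫ w in Ioi 0, P.eval (exp (-w)) * (exp (-w) * h (T * w))) atTop
      (𝓝 (∫ w in Ioi 0, P.eval (exp (-w)) * (exp (-w) * L))) := by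
  have hintL := integrableOn_exp_neg_mul_const L
  induction P using Polynomial.induction_on' with
  | add P Q hP hQ =>
    have e : ∀ g : ℝ → ℝ, ∀ w, (P + Q).eval (exp (-w)) * (exp (-w) * g w)
        = P.eval (exp (-w)) * (exp (-w) * g w) + Q.eval (exp (-w)) * (exp (-w) * g w) := by
      intro g w; rw [Polynomial.eval_add]; ring
    have e2 := integral_add (integrableOn_laplace_dilation hintL P.continuous one_pos)
      (integrableOn_laplace_dilation hintL Q.continuous one_pos)
    rw [integral_congr_ae (Eventually.of_forall (e fun _ => L)), e2]
    refine (hP.add hQ).congr' ?_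
    filter_upwards [eventually_gt_atTop 0] with T hT
    rw [integral_congr_ae (Eventually.of_forall (e fun w => h (T * w))),
      integral_add (integrableOn_laplace_dilation hint P.continuous hT)
      (integrableOn_laplace_dilation hint Q.continuous hT)]
  | monomial k a =>
    have e : ∀ g : ℝ → ℝ, ∀ w, (Polynomial.monomial k a).eval (exp (-w)) * (exp (-w) * g w)
        = a * (exp (-((k + 1 : ℝ) * w)) * g w) := by
      intro g w
      rw [Polynomial.eval_monomial, ← exp_nat_mul,
        show -((k + 1 : ℝ) * w) = k * -w + -w by ring, exp_add]
      ring
    have hk : (0 : ℝ) < k + 1 := by positivity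
    have h1 := (tendsto_laplace_dilation hlim hk).const_mul a
    have h2 : ∫ w in Ioi 0, exp (-((k + 1 : ℝ) * w)) * L = L / (k + 1) := by
      rw [integral_mul_const]
      have := integral_exp_mul_Ioi (a := -(k + 1 : ℝ)) (by linarith) 0
      simp only [neg_mul] at this
      rw [this]; field_simp; simp
    rw [integral_congr_ae (Eventually.of_forall (e fun _ => L)), integral_const_mul, h2]
    refine h1.congr fun T => ?_
    rw [integral_congr_ae (Eventually.of_forall (e fun w => h (T * w))), integral_const_mul]

/-- By Weierstrass approximation, the dilations `w ↦ h (T w)` converge to `L` when tested against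
`exp (-w)` times any continuous function of `exp (-w)`. -/
theorem tendsto_integral_continuous_dilation
    (h0 : ∀ z, 0 < z → 0 ≤ h z)
    (hint : ∀ ε : ℝ, 0 < ε → IntegrableOn (fun z => exp (-(ε * z)) * h z) (Ioi 0))
    (hlim : Tendsto (fun ε : ℝ => ε * ∫ z in Ioi 0, exp (-(ε * z)) * h z) (𝓝[>] 0) (𝓝 L))
    {q : ℝ → ℝ} (hq : Continuous q) :
    Tendsto (fun T : ℝ => ∫ w in Ioi 0, q (exp (-w)) * (exp (-w) * h (T * w))) atTop
      (𝓝 (∫ w in Ioi 0, q (exp (-w)) * (exp (-w) * L))) := by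
  have hintL := integrableOn_exp_neg_mul_const L
  have hone : Tendsto (fun T : ℝ => ∫ w in Ioi 0, exp (-w) * h (T * w)) atTop (𝓝 L) := by
    simpa using tendsto_laplace_dilation hlim one_pos
  have hLnn : 0 ≤ L := by
    refine ge_of_tendsto hone ?_
    filter_upwards [eventually_gt_atTop 0] with T hT
    exact setIntegral_nonneg measurableSet_Ioi fun w hw =>
      mul_nonneg (exp_pos _).le (h0 _ (mul_pos hT hw))
  -- replacing `q` by a `δ`-close polynomial moves the integral by at most `δ` times the mass
  have approx : ∀ (g : ℝ → ℝ), (∀ w, 0 < w → 0 ≤ g w) →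
      (∀ q : ℝ → ℝ, Continuous q →
        IntegrableOn (fun w => q (exp (-w)) * (exp (-w) * g w)) (Ioi 0)) →
      ∀ (P : Polynomial ℝ) (δ : ℝ), (∀ x ∈ Icc (0 : ℝ) 1, |P.eval x - q x| < δ) →
      |(∫ w in Ioi 0, P.eval (exp (-w)) * (exp (-w) * g w))
        - ∫ w in Ioi 0, q (exp (-w)) * (exp (-w) * g w)| ≤ δ * ∫ w in Ioi 0, exp (-w) * g w := by
    intro g hg hi P δ hP
    rw [← integral_sub (hi _ P.continuous) (hi _ hq), ← integral_const_mul, ← Real.norm_eq_abs]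
    refine norm_integral_le_of_norm_le ?_ ?_
    · exact hi (fun _ => δ) continuous_const
    · filter_upwards [ae_restrict_mem measurableSet_Ioi] with w hw
      have hnn : 0 ≤ exp (-w) * g w := mul_nonneg (exp_pos _).le (hg w hw)
      rw [← sub_mul, norm_mul, Real.norm_eq_abs, Real.norm_of_nonneg hnn]
      exact mul_le_mul_of_nonneg_right (hP _ ⟨(exp_pos _).le,
        exp_le_one_iff.2 (by simpa using le_of_lt hw)⟩).le hnn
  rw [Metric.tendsto_atTop']
  intro ε hε
  have hδ : 0 < ε / (3 * (L + 1)) := by positivity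
  obtain ⟨P, hP⟩ := exists_polynomial_near_of_continuousOn 0 1 q hq.continuousOn _ hδ
  have hL1 := approx (fun _ => L) (fun _ _ => hLnn)
    (fun q hq => by simpa using integrableOn_laplace_dilation hintL hq one_pos) P _ hP
  have hmass : ∫ w in Ioi 0, exp (-w) * L = L := by
    rw [integral_mul_const, integral_exp_neg_Ioi_zero, one_mul]
  rw [hmass] at hL1
  have hδL : ε / (3 * (L + 1)) * (L + 1) = ε / 3 := by field_simp
  obtain ⟨N, hN⟩ := (Metric.tendsto_atTop'.1
    (tendsto_integral_polynomial_dilation hint hlim P)) (ε / 3) (by positivity)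
  obtain ⟨N', hN'⟩ := eventually_atTop.1
    ((hone.eventually_lt_const (lt_add_one L)).and (eventually_gt_atTop 0))
  refine ⟨max N N', fun T hT => ?_⟩
  obtain ⟨hT1, hT2⟩ := hN' T (le_of_lt (lt_of_le_of_lt (le_max_right _ _) hT))
  have hT3 := hN T (lt_of_le_of_lt (le_max_left _ _) hT)
  have hh := approx (fun w => h (T * w)) (fun w hw => h0 _ (mul_pos hT2 hw))
    (fun q hq => integrableOn_laplace_dilation hint hq hT2) P _ hP
  have b1 : ε / (3 * (L + 1)) * ∫ w in Ioi 0, exp (-w) * h (T * w) ≤ ε / 3 := by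
    rw [← hδL]; exact mul_le_mul_of_nonneg_left hT1.le hδ.le
  have b2 : ε / (3 * (L + 1)) * L < ε / 3 := by
    rw [← hδL]; exact mul_lt_mul_of_pos_left (lt_add_one L) hδ
  rw [Real.dist_eq] at hT3 ⊢
  rw [abs_lt] at hT3 ⊢
  rw [abs_le] at hh hL1
  constructor <;> linarith [hh.1, hh.2, hL1.1, hL1.2, hT3.1, hT3.2]

/-- A nonnegative continuous `q` for which the probability density `q (exp (-w)) * exp (-w)` on
`(0, ∞)` lives on the interval `(α, β)`. -/
theorem exists_bump_test {α β : ℝ} (hα : 0 < α) (hαβ : α < β) :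
    ∃ q : ℝ → ℝ, Continuous q ∧ (∀ x, 0 ≤ q x) ∧
      (∀ w, 0 < w → q (exp (-w)) ≠ 0 → w ∈ Ioo α β) ∧
      ∫ w in Ioi 0, q (exp (-w)) * exp (-w) = 1 := by
  set f : ℝ → ℝ := fun x => max 0 ((x - exp (-β)) * (exp (-α) - x)) with hf
  have hfc : Continuous f := by fun_prop
  have hfn : ∀ x, 0 ≤ f x := fun x => le_max_left _ _
  have hsupp : ∀ w, f (exp (-w)) ≠ 0 ↔ w ∈ Ioo α β := by
    intro w
    have hlt : exp (-β) < exp (-α) := exp_lt_exp.2 (by linarith)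
    have : f (exp (-w)) ≠ 0 ↔ 0 < (exp (-w) - exp (-β)) * (exp (-α) - exp (-w)) := by
      simp only [hf, ne_eq, max_eq_left_iff, not_le]
    rw [this, mem_Ioo]
    constructor
    · intro hw
      rcases mul_pos_iff.1 hw with ⟨h1, h2⟩ | ⟨h1, h2⟩
      · rw [sub_pos, exp_lt_exp] at h1 h2
        constructor <;> linarith
      · exfalso; linarith
    · rintro ⟨h1, h2⟩
      exact mul_pos (sub_pos.2 (exp_lt_exp.2 (by linarith))) (sub_pos.2 (exp_lt_exp.2 (by linarith)))
  have hi : IntegrableOn (fun w => f (exp (-w)) * exp (-w)) (Ioi 0) := by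
    have := integrableOn_laplace_dilation (h := fun _ => 1) (by
      simpa using integrableOn_exp_neg_mul_const 1) hfc one_pos
    simpa using this
  have hpos : 0 < ∫ w in Ioi 0, f (exp (-w)) * exp (-w) := by
    rw [setIntegral_pos_iff_support_of_nonneg_ae
      (Eventually.of_forall fun w => mul_nonneg (hfn _) (exp_pos _).le) hi]
    have : Ioo α β ⊆ Function.support (fun w => f (exp (-w)) * exp (-w)) ∩ Ioi 0 := by
      intro w hw
      exact ⟨mul_ne_zero ((hsupp w).2 hw) (exp_pos _).ne', hα.trans hw.1⟩
    refine lt_of_lt_of_le ?_ (measure_mono this)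
    simpa using hαβ
  refine ⟨fun x => (∫ w in Ioi 0, f (exp (-w)) * exp (-w))⁻¹ * f x, by fun_prop,
    fun x => mul_nonneg (inv_nonneg.2 hpos.le) (hfn x), fun w _ hw => ?_, ?_⟩
  · exact (hsupp w).1 (right_ne_zero_of_mul hw)
  · simp_rw [mul_assoc]
    rw [integral_const_mul, inv_mul_cancel₀ hpos.ne']

/-- **Karamata's theorem** with a one-sided growth condition. If `h ≥ 0`, `z ↦ h z / z ^ K` is
nonincreasing on `(0, ∞)`, and `ε` times the Laplace transform of `h` at `ε` tends to `L` as
`ε → 0⁺`, then `h` itself tends to `L`. -/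
theorem tendsto_of_tendsto_laplace {K : ℕ}
    (h0 : ∀ z, 0 < z → 0 ≤ h z)
    (hscale : ∀ r z : ℝ, 1 ≤ r → 0 < z → h (r * z) ≤ r ^ K * h z)
    (hint : ∀ ε : ℝ, 0 < ε → IntegrableOn (fun z => exp (-(ε * z)) * h z) (Ioi 0))
    (hlim : Tendsto (fun ε : ℝ => ε * ∫ z in Ioi 0, exp (-(ε * z)) * h z) (𝓝[>] 0) (𝓝 L)) :
    Tendsto h atTop (𝓝 L) := by
  have tot : ∀ (q : ℝ → ℝ) (C : ℝ), ∫ w in Ioi 0, q (exp (-w)) * exp (-w) = 1 →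
      ∫ w in Ioi 0, q (exp (-w)) * (exp (-w) * C) = C := by
    intro q C hq
    simp_rw [← mul_assoc]
    rw [integral_mul_const, hq, one_mul]
  have hpow : ∀ c : ℝ, Tendsto (fun r : ℝ => c * r ^ K) (𝓝[>] 1) (𝓝 c) := by
    intro c
    have : ContinuousAt (fun r : ℝ => c * r ^ K) 1 := by fun_prop
    simpa [ContinuousAt] using this.mono_left nhdsWithin_le_nhds
  refine tendsto_order.2 ⟨fun a ha => ?_, fun b hb => ?_⟩
  · -- `h T` dominates `r⁻ᴷ h (T w)` for `w ∈ (1, r)`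
    obtain ⟨r, hr, hr1⟩ :=
      (((hpow a).eventually_lt_const ha).and self_mem_nhdsWithin).exists
    obtain ⟨q, hqc, hqn, hqs, hq1⟩ := exists_bump_test one_pos hr1
    have ht := tendsto_integral_continuous_dilation h0 hint hlim hqc
    rw [tot q L hq1] at ht
    filter_upwards [ht.eventually_const_lt hr, eventually_gt_atTop 0] with T hT hT0
    have hr0 : (0 : ℝ) < r := zero_lt_one.trans hr1
    have hle : ∫ w in Ioi 0, q (exp (-w)) * (exp (-w) * h (T * w))
        ≤ ∫ w in Ioi 0, q (exp (-w)) * (exp (-w) * (r ^ K * h T)) := by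
      refine setIntegral_mono_on (integrableOn_laplace_dilation hint hqc hT0)
        (by simpa using integrableOn_laplace_dilation (integrableOn_exp_neg_mul_const (r ^ K * h T)) hqc one_pos)
        measurableSet_Ioi fun w hw => ?_
      by_cases hz : q (exp (-w)) = 0
      · simp [hz]
      obtain ⟨h1, h2⟩ := hqs w hw hz
      refine mul_le_mul_of_nonneg_left (mul_le_mul_of_nonneg_left ?_ (exp_pos _).le) (hqn _)
      rw [mul_comm T w]
      exact (hscale w T h1.le hT0).trans
        (mul_le_mul_of_nonneg_right (pow_le_pow_left₀ (le_of_lt hw) h2.le K) (h0 T hT0))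
    rw [tot q _ hq1] at hle
    have : a * r ^ K < h T * r ^ K := by linarith
    exact lt_of_mul_lt_mul_right this (by positivity)
  · -- `h T` is dominated by `rᴷ h (T w)` for `w ∈ (r⁻¹, 1)`
    obtain ⟨r, hr, hr1⟩ :=
      (((hpow L).eventually_lt_const hb).and self_mem_nhdsWithin).exists
    have hr0 : (0 : ℝ) < r := zero_lt_one.trans hr1
    obtain ⟨q, hqc, hqn, hqs, hq1⟩ := exists_bump_test (inv_pos.2 hr0) (inv_lt_one_of_one_lt₀ hr1)
    have ht := tendsto_integral_continuous_dilation h0 hint hlim hqc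
    rw [tot q L hq1] at ht
    filter_upwards [(ht.mul_const (r ^ K)).eventually_lt_const hr, eventually_gt_atTop 0]
      with T hT hT0
    have hle : ∫ w in Ioi 0, q (exp (-w)) * (exp (-w) * ((r ^ K)⁻¹ * h T))
        ≤ ∫ w in Ioi 0, q (exp (-w)) * (exp (-w) * h (T * w)) := by
      refine setIntegral_mono_on
        (by simpa using integrableOn_laplace_dilation (integrableOn_exp_neg_mul_const ((r ^ K)⁻¹ * h T)) hqc one_pos)
        (integrableOn_laplace_dilation hint hqc hT0)
        measurableSet_Ioi fun w hw => ?_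
      by_cases hz : q (exp (-w)) = 0
      · simp [hz]
      obtain ⟨h1, h2⟩ := hqs w hw hz
      have hw0 : (0 : ℝ) < w := hw
      refine mul_le_mul_of_nonneg_left (mul_le_mul_of_nonneg_left ?_ (exp_pos _).le) (hqn _)
      have hTw : 0 < T * w := mul_pos hT0 hw0
      have h3 := hscale w⁻¹ (T * w) (one_le_inv_iff₀.2 ⟨hw0, h2.le⟩) hTw
      rw [show w⁻¹ * (T * w) = T by field_simp] at h3
      rw [inv_mul_le_iff₀ (by positivity)]
      exact h3.trans (mul_le_mul_of_nonneg_right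
        (pow_le_pow_left₀ (by positivity) (inv_le_of_inv_le₀ hr0 h1.le) K) (h0 _ hTw))
    rw [tot q _ hq1, inv_mul_le_iff₀ (by positivity)] at hle
    linarith

end Tauberian

/-! ### The Gamma function and the Volterra function -/

section VolterraFunction

open Real Set

/-- The derivative of the convex function `log Γ` at `x + 1` is at least its slope `log x` over
`[x, x + 1]`. -/
theorem log_le_deriv_log_Gamma {x : ℝ} (hx : 0 < x) :
    log x ≤ deriv (log ∘ Gamma) (x + 1) := by
  have hd : DifferentiableAt ℝ (log ∘ Gamma) (x + 1) :=
    (differentiableAt_Gamma fun m => by have : (0 : ℝ) ≤ m := m.cast_nonneg; linarith).log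
      (Gamma_pos_of_pos (by linarith)).ne'
  have h := convexOn_log_Gamma.slope_le_deriv (x := x) (y := x + 1) hx
    (show (0 : ℝ) < x + 1 by linarith) (by linarith) hd
  rw [slope_def_field, Function.comp, Function.comp, Gamma_add_one hx.ne',
    log_mul hx.ne' (Gamma_pos_of_pos hx).ne'] at h
  simpa using h

/-- The continuous Poisson weight `exp (-y) * y ^ x / Γ (x + 1)` decreases when intensity and
argument are scaled up together. -/
theorem exp_neg_mul_rpow_div_Gamma_scale {r x y : ℝ} (hr : 1 ≤ r) (hx : 0 ≤ x) (hy : 0 < y) :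
    exp (-(r * y)) * (r * y) ^ (r * x) / Gamma (r * x + 1)
      ≤ exp (-y) * y ^ x / Gamma (x + 1) := by
  rcases hx.eq_or_lt with rfl | hx
  · simp only [mul_zero, rpow_zero]
    gcongr
    nlinarith
  have hderiv : ∀ t : ℝ, 0 < t → HasDerivAt
      (fun t => -(t * y) + t * x * log (t * y) - (log ∘ Gamma) (t * x + 1))
      (-y + (x * log (t * y) + t * x * (y / (t * y))) - deriv (log ∘ Gamma) (t * x + 1) * x) t := by
    intro t ht
    have htx : 0 < t * x + 1 := by positivity
    have hG : HasDerivAt (log ∘ Gamma) (deriv (log ∘ Gamma) (t * x + 1)) (t * x + 1) :=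
      ((differentiableAt_Gamma fun m => by
        have : (0 : ℝ) ≤ m := m.cast_nonneg; linarith).log (Gamma_pos_of_pos htx).ne').hasDerivAt
    have h1 : HasDerivAt (fun t : ℝ => t * x + 1) x t := by
      simpa using ((hasDerivAt_id t).mul_const x).add_const 1
    have h2 : HasDerivAt (fun t : ℝ => t * x) x t := by
      simpa using (hasDerivAt_id t).mul_const x
    have h3 : HasDerivAt (fun t : ℝ => t * y) y t := by
      simpa using (hasDerivAt_id t).mul_const y
    exact (h3.neg.add (h2.mul (h3.log (by positivity)))).sub (HasDerivAt.comp (h₂ := log ∘ Gamma) t hG h1)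
  have hanti : AntitoneOn
      (fun t => -(t * y) + t * x * log (t * y) - (log ∘ Gamma) (t * x + 1)) (Ici 1) := by
    refine antitoneOn_of_hasDerivWithinAt_nonpos (convex_Ici 1)
      (fun t ht => (hderiv t (zero_lt_one.trans_le ht)).continuousAt.continuousWithinAt)
      (fun t ht => (hderiv t ?_).hasDerivWithinAt) (fun t ht => ?_)
    · rw [interior_Ici] at ht; exact zero_lt_one.trans ht
    · rw [interior_Ici] at ht
      have ht0 : 0 < t := zero_lt_one.trans ht
      have h1 := log_le_deriv_log_Gamma (mul_pos ht0 hx)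
      have h2 := mul_le_mul_of_nonneg_right h1 hx.le
      have h3 : t * x * (y / (t * y)) = x := by field_simp
      -- after cancelling `log t`, the sign of the derivative is `x * log (y / x) ≤ y - x`
      have h4 := mul_le_mul_of_nonneg_left (log_le_sub_one_of_pos (div_pos hy hx)) hx.le
      rw [log_div hy.ne' hx.ne'] at h4
      have h5 : x * (y / x - 1) = y - x := by field_simp
      rw [log_mul ht0.ne' hx.ne'] at h2
      rw [log_mul ht0.ne' hy.ne', h3]
      linarith
  have key := hanti (mem_Ici.2 le_rfl) (mem_Ici.2 hr) hr
  have form : ∀ t : ℝ, 1 ≤ t → exp (-(t * y)) * (t * y) ^ (t * x) / Gamma (t * x + 1)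
      = exp (-(t * y) + t * x * log (t * y) - (log ∘ Gamma) (t * x + 1)) := by
    intro t ht
    have ht0 : 0 < t := zero_lt_one.trans_le ht
    rw [exp_sub, exp_add, Function.comp, exp_log (Gamma_pos_of_pos (by positivity)),
      rpow_def_of_pos (by positivity), mul_comm (log (t * y))]
  have f1 := form 1 le_rfl
  rw [form r hr]
  simp only [one_mul] at f1 key
  rw [f1]
  exact exp_le_exp.2 key

/-- `Γ` outgrows every exponential: keep only `[c, c + 1]` in Euler's integral. -/
theorem exp_mul_rpow_le_Gamma {c x : ℝ} (hc : 0 < c) (hx : 0 ≤ x) :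
    exp (-(c + 1)) * c ^ x ≤ Gamma (x + 1) := by
  rw [Gamma_eq_integral (by linarith)]
  have hi := GammaIntegral_convergent (s := x + 1) (by linarith)
  simp only [add_sub_cancel_right] at hi ⊢
  have hsub : Ioc c (c + 1) ⊆ Ioi 0 := fun u hu => hc.trans hu.1
  calc exp (-(c + 1)) * c ^ x = ∫ _ in Ioc c (c + 1), exp (-(c + 1)) * c ^ x := by simp
    _ ≤ ∫ u in Ioc c (c + 1), exp (-u) * u ^ x := by
      refine setIntegral_mono_on (integrableOn_const (by simp)) (hi.mono_set hsub) measurableSet_Ioc fun u hu => ?_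
      exact mul_le_mul (exp_le_exp.2 (by linarith [hu.2]))
        (rpow_le_rpow hc.le hu.1.le hx) (by positivity) (exp_pos _).le
    _ ≤ ∫ u in Ioi 0, exp (-u) * u ^ x := by
      refine setIntegral_mono_set hi ?_ hsub.eventuallyLE
      filter_upwards [ae_restrict_mem measurableSet_Ioi] with u hu
      have hu : (0 : ℝ) < u := hu
      simp only [Pi.zero_apply]
      positivity

/-- The absolute value keeps the argument away from the poles of `Γ`, which gives a globally
continuous replacement for `x ↦ Γ (x + 1)` on `x ≥ 0` in measurability arguments. -/
theorem continuous_Gamma_abs_add_one : Continuous fun x : ℝ => Gamma (|x| + 1) := by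
  refine continuous_iff_continuousAt.2 fun x => ?_
  have : ContinuousAt Gamma (|x| + 1) := (differentiableAt_Gamma fun m => by
    have : (0 : ℝ) ≤ m := m.cast_nonneg
    have := abs_nonneg x
    linarith).continuousAt
  exact ContinuousAt.comp (f := fun x : ℝ => |x| + 1) this (by fun_prop)

/-- Volterra's function `ν(y) = ∫₀^∞ y ^ x / Γ (x + 1) dx`, the continuous analogue of the
exponential series. Only its values at `y > 0` are meaningful. -/
noncomputable def volterraNu (y : ℝ) : ℝ := ∫ x in Ici 0, y ^ x / Gamma (x + 1)

theorem measurable_rpow_div_Gamma_abs :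
    Measurable fun p : ℝ × ℝ => p.1 ^ p.2 / Gamma (|p.2| + 1) :=
  (measurable_fst.pow measurable_snd).div
    (continuous_Gamma_abs_add_one.measurable.comp measurable_snd)

theorem integrableOn_rpow_div_Gamma {y : ℝ} (hy : 0 < y) :
    IntegrableOn (fun x => y ^ x / Gamma (x + 1)) (Ici 0) := by
  have hdom : IntegrableOn (fun x => exp (-(log 2 * x)) * exp (2 * y + 1)) (Ici 0) :=
    (integrableOn_exp_neg_mul_const (exp (2 * y + 1)) (log 2) (log_pos (by norm_num))).congr_set_ae
      Ioi_ae_eq_Ici.symm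
  refine Integrable.mono' hdom ?_ ?_
  · have h1 : Measurable fun x : ℝ => y ^ x / Gamma (|x| + 1) :=
      measurable_rpow_div_Gamma_abs.comp (measurable_const.prodMk measurable_id)
    refine (h1.aemeasurable.congr ?_).aestronglyMeasurable
    filter_upwards [ae_restrict_mem measurableSet_Ici] with x hx
    rw [abs_of_nonneg hx]
  · filter_upwards [ae_restrict_mem measurableSet_Ici] with x hx
    have hx : 0 ≤ x := hx
    have hG := Gamma_pos_of_pos (show 0 < x + 1 by linarith)
    rw [norm_of_nonneg (by positivity), div_le_iff₀ hG]
    refine le_trans (le_of_eq ?_) (mul_le_mul_of_nonneg_left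
      (exp_mul_rpow_le_Gamma (show 0 < 2 * y by positivity) hx) (by positivity))
    rw [mul_rpow (by norm_num) hy.le, rpow_def_of_pos (show (0 : ℝ) < 2 by norm_num)]
    have : exp (-(log 2 * x)) * exp (2 * y + 1) * (exp (-(2 * y + 1)) * (exp (log 2 * x) * y ^ x))
        = exp (-(log 2 * x) + (2 * y + 1) + -(2 * y + 1) + log 2 * x) * y ^ x := by
      simp only [exp_add]; ring
    rw [this]
    ring_nf
    simp

theorem volterraNu_nonneg {y : ℝ} (hy : 0 < y) : 0 ≤ volterraNu y :=
  setIntegral_nonneg measurableSet_Ici fun x (hx : 0 ≤ x) =>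
    div_nonneg (rpow_nonneg hy.le _) (Gamma_pos_of_pos (by linarith)).le

theorem ofReal_volterraNu {y : ℝ} (hy : 0 < y) :
    ENNReal.ofReal (volterraNu y) = ∫⁻ x in Ici 0, ENNReal.ofReal (y ^ x / Gamma (x + 1)) := by
  refine ofReal_integral_eq_lintegral_ofReal (integrableOn_rpow_div_Gamma hy) ?_
  filter_upwards [ae_restrict_mem measurableSet_Ici] with x hx
  exact div_nonneg (rpow_nonneg hy.le _) (Gamma_pos_of_pos (by linarith [mem_Ici.1 hx])).le

theorem measurable_volterraNu : Measurable volterraNu := by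
  have h : volterraNu = fun y => ∫ x in Ici 0, y ^ x / Gamma (|x| + 1) := by
    funext y
    refine setIntegral_congr_fun measurableSet_Ici fun x hx => ?_
    simp only [abs_of_nonneg (mem_Ici.1 hx)]
  rw [h]
  exact (measurable_rpow_div_Gamma_abs.stronglyMeasurable.integral_prod_right
    (ν := volume.restrict (Ici 0))).measurable

theorem volterraNu_le_of_le_one {y : ℝ} (hy : 0 < y) (hy1 : y ≤ 1) :
    volterraNu y ≤ volterraNu 1 := by
  refine setIntegral_mono_on (integrableOn_rpow_div_Gamma hy)
    (integrableOn_rpow_div_Gamma one_pos) measurableSet_Ici fun x hx => ?_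
  exact div_le_div_of_nonneg_right (rpow_le_rpow hy.le hy1 hx)
    (Gamma_pos_of_pos (by linarith [mem_Ici.1 hx])).le

theorem exp_neg_mul_volterraNu_scale {r y : ℝ} (hr : 1 ≤ r) (hy : 0 < y) :
    exp (-(r * y)) * volterraNu (r * y) ≤ r ^ 1 * (exp (-y) * volterraNu y) := by
  have hr0 : 0 < r := zero_lt_one.trans_le hr
  have hry : 0 < r * y := mul_pos hr0 hy
  have h1 := integral_comp_mul_left_Ioi
    (fun x => exp (-(r * y)) * ((r * y) ^ x / Gamma (x + 1))) 0 hr0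
  have h2 := (integrableOn_Ioi_comp_mul_left_iff
    (fun x => exp (-(r * y)) * ((r * y) ^ x / Gamma (x + 1))) 0 hr0).2 (by
      rw [mul_zero]
      exact ((integrableOn_rpow_div_Gamma hry).mono_set Ioi_subset_Ici_self).const_mul _)
  rw [mul_zero, smul_eq_mul] at h1
  unfold volterraNu
  rw [← integral_const_mul, ← integral_const_mul, integral_Ici_eq_integral_Ioi,
    integral_Ici_eq_integral_Ioi, pow_one, ← inv_mul_le_iff₀ hr0, ← h1]
  refine setIntegral_mono_on h2
    (((integrableOn_rpow_div_Gamma hy).mono_set Ioi_subset_Ici_self).const_mul _)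
    measurableSet_Ioi fun x hx => ?_
  simpa only [mul_div_assoc] using exp_neg_mul_rpow_div_Gamma_scale hr (le_of_lt hx) hy

theorem lintegral_exp_neg_mul_rpow {c x : ℝ} (hc : 0 < c) (hx : 0 ≤ x) :
    ∫⁻ u in Ioi 0, ENNReal.ofReal (exp (-(c * u)) * u ^ x)
      = ENNReal.ofReal (c ^ (-(x + 1)) * Gamma (x + 1)) := by
  have h := integral_rpow_mul_exp_neg_mul_Ioi (a := x + 1) (r := c) (by linarith) hc
  have hi : IntegrableOn (fun u : ℝ => exp (-(c * u)) * u ^ x) (Ioi 0) := by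
    have := integrableOn_rpow_mul_exp_neg_mul_rpow (s := x) (p := 1) (b := c) (by linarith)
      one_pos hc
    refine this.congr_fun (fun u _ => ?_) measurableSet_Ioi
    simp only [rpow_one, neg_mul]
    ring
  rw [← ofReal_integral_eq_lintegral_ofReal hi]
  · congr 1
    rw [rpow_neg hc.le, ← inv_rpow hc.le, ← one_div, ← h]
    refine integral_congr_ae (Eventually.of_forall fun u => ?_)
    simp only [add_sub_cancel_right]
    ring
  · filter_upwards [ae_restrict_mem measurableSet_Ioi] with u hu
    have hu : (0 : ℝ) < u := hu
    simp only [Pi.zero_apply]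
    positivity

/-- The Laplace transform of `exp (-y) * ν y` at `ε` is `∫₀^∞ (1 + ε) ^ (-x - 1) dx`. -/
theorem lintegral_exp_neg_mul_volterraNu {ε : ℝ} (hε : 0 < ε) :
    ∫⁻ y in Ioi 0, ENNReal.ofReal (exp (-(ε * y)) * (exp (-y) * volterraNu y))
      = ENNReal.ofReal (((1 + ε) * log (1 + ε))⁻¹) := by
  have hl : 0 < log (1 + ε) := log_pos (by linarith)
  have h1 : ∫⁻ y in Ioi 0, ENNReal.ofReal (exp (-(ε * y)) * (exp (-y) * volterraNu y))
      = ∫⁻ y in Ioi 0, ∫⁻ x in Ici 0,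
        ENNReal.ofReal (exp (-((1 + ε) * y)) * (y ^ x / Gamma (|x| + 1))) := by
    refine setLIntegral_congr_fun measurableSet_Ioi fun y hy => ?_
    rw [← mul_assoc, ← exp_add, ENNReal.ofReal_mul (exp_pos _).le, ofReal_volterraNu hy,
      ← lintegral_const_mul' _ _ ENNReal.ofReal_ne_top]
    refine setLIntegral_congr_fun measurableSet_Ici fun x hx => ?_
    simp only [abs_of_nonneg (mem_Ici.1 hx)]
    rw [ENNReal.ofReal_mul (exp_pos _).le]
    congr 3
    ring
  have h2 : ∫⁻ x in Ici 0, ∫⁻ y in Ioi 0,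
        ENNReal.ofReal (exp (-((1 + ε) * y)) * (y ^ x / Gamma (|x| + 1)))
      = ∫⁻ x in Ici 0, ENNReal.ofReal (exp (-(log (1 + ε) * x)) * (1 + ε)⁻¹) := by
    refine setLIntegral_congr_fun measurableSet_Ici fun x hx => ?_
    have hx : 0 ≤ x := hx
    have hG := Gamma_pos_of_pos (show 0 < x + 1 by linarith)
    simp only [abs_of_nonneg hx]
    have e : ∀ y : ℝ, ENNReal.ofReal (exp (-((1 + ε) * y)) * (y ^ x / Gamma (x + 1)))
        = ENNReal.ofReal (Gamma (x + 1))⁻¹ * ENNReal.ofReal (exp (-((1 + ε) * y)) * y ^ x) := by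
      intro y
      rw [← ENNReal.ofReal_mul (by positivity)]
      congr 1; field_simp
    simp_rw [e]
    rw [lintegral_const_mul' _ _ ENNReal.ofReal_ne_top,
      lintegral_exp_neg_mul_rpow (by linarith) hx, ← ENNReal.ofReal_mul (by positivity)]
    congr 1
    rw [neg_add, rpow_add (by linarith), rpow_neg_one, rpow_def_of_pos (by linarith)]
    field_simp
  rw [h1, lintegral_lintegral_swap, h2]
  · rw [setLIntegral_congr Ioi_ae_eq_Ici.symm, ← ofReal_integral_eq_lintegral_ofReal
      (integrableOn_exp_neg_mul_const _ _ hl) (Eventually.of_forall fun x => by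
        simp only [Pi.zero_apply]; positivity), integral_mul_const]
    have := integral_exp_mul_Ioi (a := -log (1 + ε)) (by linarith) 0
    simp only [neg_mul] at this
    rw [this]
    congr 1
    field_simp
    simp
  · refine Measurable.aemeasurable (ENNReal.measurable_ofReal.comp ?_)
    exact Measurable.mul (by fun_prop) measurable_rpow_div_Gamma_abs

theorem integrableOn_laplace_volterraNu {ε : ℝ} (hε : 0 < ε) :
    IntegrableOn (fun y => exp (-(ε * y)) * (exp (-y) * volterraNu y)) (Ioi 0) := by
  refine ⟨(Measurable.mul (by fun_prop)
    (Measurable.mul (by fun_prop) measurable_volterraNu)).aestronglyMeasurable, ?_⟩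
  rw [hasFiniteIntegral_iff_ofReal, lintegral_exp_neg_mul_volterraNu hε]
  · exact ENNReal.ofReal_lt_top
  · filter_upwards [ae_restrict_mem measurableSet_Ioi] with y hy
    have := volterraNu_nonneg hy
    simp only [Pi.zero_apply]
    positivity

/-- `ν(y) ∼ exp y`: the total mass of the continuous Poisson weights tends to `1`. -/
theorem tendsto_exp_neg_mul_volterraNu :
    Tendsto (fun y => exp (-y) * volterraNu y) atTop (𝓝 1) := by
  refine tendsto_of_tendsto_laplace (K := 1)
    (fun y hy => mul_nonneg (exp_pos _).le (volterraNu_nonneg hy))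
    (fun r y hr hy => exp_neg_mul_volterraNu_scale hr hy)
    (fun ε hε => integrableOn_laplace_volterraNu hε) ?_
  have hd : Tendsto (fun ε : ℝ => ε⁻¹ * log (1 + ε)) (𝓝[>] 0) (𝓝 1) := by
    have h : HasDerivAt (fun ε : ℝ => log (1 + ε)) 1 0 := by
      simpa using ((hasDerivAt_id (0 : ℝ)).const_add 1).log (by simp)
    have := h.tendsto_slope_zero_right
    simpa using this
  have h1 : Tendsto (fun ε : ℝ => 1 + ε) (𝓝[>] 0) (𝓝 1) := by
    have : ContinuousAt (fun ε : ℝ => 1 + ε) 0 := by fun_prop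
    simpa [ContinuousAt] using this.mono_left nhdsWithin_le_nhds
  have h2 := (h1.mul hd).inv₀ (by norm_num)
  rw [mul_one, inv_one] at h2
  refine h2.congr' ?_
  filter_upwards [self_mem_nhdsWithin] with ε hε
  have hε : 0 < ε := hε
  have hl : 0 < log (1 + ε) := log_pos (by linarith)
  rw [integral_eq_lintegral_of_nonneg_ae, lintegral_exp_neg_mul_volterraNu hε,
    ENNReal.toReal_ofReal (by positivity)]
  · field_simp
  · filter_upwards [ae_restrict_mem measurableSet_Ioi] with y hy
    have := volterraNu_nonneg hy
    simp only [Pi.zero_apply]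
    positivity
  · exact (integrableOn_laplace_volterraNu hε).aestronglyMeasurable

theorem exists_bound_exp_neg_mul_volterraNu :
    ∃ C : ℝ, ∀ y, 0 < y → exp (-y) * volterraNu y ≤ C := by
  obtain ⟨Y, hY⟩ := eventually_atTop.1
    (tendsto_exp_neg_mul_volterraNu.eventually_le_const one_lt_two)
  have h1 := volterraNu_nonneg one_pos
  refine ⟨volterraNu 1 + |Y| * volterraNu 1 + 2, fun y hy => ?_⟩
  have hY1 : 0 ≤ |Y| * volterraNu 1 := by positivity
  have hle : ∀ t, 0 < t → exp (-t) ≤ 1 := fun t ht => exp_le_one_iff.2 (by linarith)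
  rcases le_total y 1 with hy1 | hy1
  · have := mul_le_mul (hle y hy) (volterraNu_le_of_le_one hy hy1) (volterraNu_nonneg hy)
      zero_le_one
    linarith
  rcases le_total Y y with hYy | hYy
  · linarith [hY y hYy]
  · have h := exp_neg_mul_volterraNu_scale hy1 one_pos
    rw [mul_one, pow_one] at h
    have h2 : y * (exp (-1) * volterraNu 1) ≤ |Y| * (1 * volterraNu 1) :=
      mul_le_mul (hYy.trans (le_abs_self Y))
        (mul_le_mul_of_nonneg_right (hle 1 one_pos) h1) (by positivity) (abs_nonneg Y)
    linarith

end VolterraFunction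

/-! ### The multinomial coefficient as a Gamma mixture -/

section MultinomialDensity

open Real Set

variable {n : ℕ}

theorem continuousOn_multinomialReal :
    ContinuousOn (multinomialReal : (Fin n → ℝ) → ℝ) (Ici 0) := by
  have h : Continuous fun x : Fin n → ℝ =>
      Gamma (|∑ i, x i| + 1) / ∏ i, Gamma (|x i| + 1) := by
    refine Continuous.div (continuous_Gamma_abs_add_one.comp (by fun_prop))
      (continuous_finsetProd _ fun i _ => continuous_Gamma_abs_add_one.comp (by fun_prop))
      fun x => Finset.prod_ne_zero_iff.2 fun i _ => (Gamma_pos_of_pos (by positivity)).ne'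
  refine h.continuousOn.congr fun x hx => ?_
  have hx : ∀ i, 0 ≤ x i := hx
  simp only [multinomialReal, abs_of_nonneg (hx _), abs_of_nonneg (Finset.sum_nonneg fun i _ => hx i)]

theorem multinomialReal_nonneg {x : Fin n → ℝ} (hx : 0 ≤ x) : 0 ≤ multinomialReal x :=
  div_nonneg (Gamma_nonneg_of_nonneg (by
      have : 0 ≤ ∑ i, x i := Finset.sum_nonneg fun i _ => hx i
      linarith))
    (Finset.prod_nonneg fun i _ => Gamma_nonneg_of_nonneg (by linarith [show 0 ≤ x i from hx i]))

theorem prod_rpow_div_Gamma_eq {b x : Fin n → ℝ} (hb : ∀ i, 0 < b i) {u : ℝ} (hu : 0 < u) :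
    exp (-u) * ∏ i, (u * b i) ^ x i / Gamma (x i + 1)
      = exp (-u) * u ^ (∑ i, x i) * ∏ i, b i ^ x i / Gamma (x i + 1) := by
  rw [rpow_sum_of_pos hu, mul_assoc, ← Finset.prod_mul_distrib]
  congr 1
  refine Finset.prod_congr rfl fun i _ => ?_
  rw [mul_rpow hu.le (hb i).le, mul_div_assoc]

theorem integrableOn_prod_rpow_div_Gamma {b x : Fin n → ℝ} (hb : ∀ i, 0 < b i) (hx : 0 ≤ x) :
    IntegrableOn (fun u => exp (-u) * ∏ i, (u * b i) ^ x i / Gamma (x i + 1)) (Ioi 0) := by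
  have hs : 0 ≤ ∑ i, x i := Finset.sum_nonneg fun i _ => hx i
  have hi := (GammaIntegral_convergent (s := (∑ i, x i) + 1) (by linarith)).mul_const
    (∏ i, b i ^ x i / Gamma (x i + 1))
  refine IntegrableOn.congr_fun hi (fun u hu => ?_) measurableSet_Ioi
  simp only [prod_rpow_div_Gamma_eq hb hu, add_sub_cancel_right]

/-- Expanding the numerator `Γ (∑ xᵢ + 1)` as Euler's integral splits the multinomial coefficient
into a mixture over `u` of products of one-variable weights. -/
theorem multinomialReal_mul_prod_rpow {b x : Fin n → ℝ} (hb : ∀ i, 0 < b i) (hx : 0 ≤ x) :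
    multinomialReal x * ∏ i, b i ^ x i
      = ∫ u in Ioi 0, exp (-u) * ∏ i, (u * b i) ^ x i / Gamma (x i + 1) := by
  have hs : 0 ≤ ∑ i, x i := Finset.sum_nonneg fun i _ => hx i
  rw [setIntegral_congr_fun measurableSet_Ioi fun u hu => prod_rpow_div_Gamma_eq hb hu,
    integral_mul_const, multinomialReal, Gamma_eq_integral (by linarith), Finset.prod_div_distrib]
  simp only [add_sub_cancel_right]
  ring

/-- Since `∑ pᵢ = 1`, the factor `exp (-u)` of the mixture splits as `∏ exp (-u pᵢ)`, and the
monotonicity of the Poisson weights applies factor by factor; the factor `r` comes from the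
substitution in `u`. -/
theorem multinomialReal_mul_prod_rpow_scale {p x : Fin n → ℝ} (hp : ∀ i, 0 < p i)
    (hsum : ∑ i, p i = 1) (hx : 0 ≤ x) {r : ℝ} (hr : 1 ≤ r) :
    multinomialReal (r • x) * ∏ i, p i ^ (r * x i)
      ≤ r * (multinomialReal x * ∏ i, p i ^ x i) := by
  have hr0 : 0 < r := zero_lt_one.trans_le hr
  have hrx : 0 ≤ r • x := smul_nonneg hr0.le hx
  have h1 := multinomialReal_mul_prod_rpow hp hrx
  have hi := integrableOn_prod_rpow_div_Gamma hp hrx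
  simp only [Pi.smul_apply, smul_eq_mul] at h1 hi
  have h2 := integral_comp_mul_left_Ioi
    (fun u => exp (-u) * ∏ i, (u * p i) ^ (r * x i) / Gamma (r * x i + 1)) 0 hr0
  have h3 := (integrableOn_Ioi_comp_mul_left_iff
    (fun u => exp (-u) * ∏ i, (u * p i) ^ (r * x i) / Gamma (r * x i + 1)) 0 hr0).2 (by
      rwa [mul_zero])
  rw [mul_zero, smul_eq_mul] at h2
  rw [h1, multinomialReal_mul_prod_rpow hp hx, ← inv_mul_le_iff₀ hr0, ← h2]
  refine setIntegral_mono_on h3 (integrableOn_prod_rpow_div_Gamma hp hx) measurableSet_Ioi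
    fun u hu => ?_
  have hu : 0 < u := hu
  have hexp : ∀ t : ℝ, exp (-t) = ∏ i, exp (-(t * p i)) := fun t => by
    rw [← exp_sum, Finset.sum_neg_distrib, ← Finset.mul_sum, hsum, mul_one]
  rw [hexp u, hexp (r * u), ← Finset.prod_mul_distrib, ← Finset.prod_mul_distrib]
  refine Finset.prod_le_prod (fun i _ => ?_) fun i _ => ?_
  · have := Gamma_pos_of_pos (show 0 < r * x i + 1 by
      have : 0 ≤ r * x i := mul_nonneg hr0.le (hx i)
      linarith)
    have := hp i
    positivity
  · have := exp_neg_mul_rpow_div_Gamma_scale hr (hx i) (mul_pos hu (hp i))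
    simpa only [mul_assoc, mul_div_assoc] using this

theorem volume_restrict_Ici_zero :
    (volume : Measure (Fin n → ℝ)).restrict (Ici 0)
      = Measure.pi fun _ => (volume : Measure ℝ).restrict (Ici 0) := by
  rw [← Measure.restrict_pi_pi, volume_pi, pi_univ_Ici]
  rfl

/-- The generating integral of the real multinomial coefficients over the orthant. -/
theorem lintegral_multinomialReal_mul_prod_rpow {b : Fin n → ℝ} (hb : ∀ i, 0 < b i) :
    ∫⁻ x in Ici 0, ENNReal.ofReal (multinomialReal x * ∏ i, b i ^ x i)
      = ∫⁻ u in Ioi 0, ENNReal.ofReal (exp (-u) * ∏ i, volterraNu (u * b i)) := by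
  have h1 : ∫⁻ x in Ici 0, ENNReal.ofReal (multinomialReal x * ∏ i, b i ^ x i)
      = ∫⁻ x in Ici (0 : Fin n → ℝ), ∫⁻ u in Ioi 0,
        ENNReal.ofReal (exp (-u) * ∏ i, (u * b i) ^ x i / Gamma (|x i| + 1)) := by
    refine setLIntegral_congr_fun measurableSet_Ici fun x hx => ?_
    have hx : 0 ≤ x := hx
    have hx' : ∀ i, |x i| = x i := fun i => abs_of_nonneg (hx i)
    simp only [hx']
    rw [multinomialReal_mul_prod_rpow hb hx, ofReal_integral_eq_lintegral_ofReal
      (integrableOn_prod_rpow_div_Gamma hb hx)]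
    filter_upwards [ae_restrict_mem measurableSet_Ioi] with u hu
    refine mul_nonneg (exp_pos _).le (Finset.prod_nonneg fun i _ => div_nonneg
      (rpow_nonneg (mul_pos hu (hb i)).le _) (Gamma_nonneg_of_nonneg ?_))
    linarith [show 0 ≤ x i from hx i]
  have h2 : ∀ u ∈ Ioi (0 : ℝ), ∫⁻ x in Ici (0 : Fin n → ℝ),
        ENNReal.ofReal (exp (-u) * ∏ i, (u * b i) ^ x i / Gamma (|x i| + 1))
      = ENNReal.ofReal (exp (-u) * ∏ i, volterraNu (u * b i)) := by
    intro u hu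
    have hub : ∀ i, 0 < u * b i := fun i => mul_pos hu (hb i)
    have hcongr : ∀ i, ∀ t ∈ Ici (0 : ℝ), (u * b i) ^ t / Gamma (t + 1)
        = (u * b i) ^ t / Gamma (|t| + 1) := fun i t ht => by rw [abs_of_nonneg (mem_Ici.1 ht)]
    have hi : ∀ i, Integrable (fun t => (u * b i) ^ t / Gamma (|t| + 1))
        (volume.restrict (Ici 0)) := fun i =>
      IntegrableOn.congr_fun (integrableOn_rpow_div_Gamma (hub i)) (hcongr i) measurableSet_Ici
    rw [volume_restrict_Ici_zero, ← ofReal_integral_eq_lintegral_ofReal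
      ((Integrable.fintype_prod hi).const_mul _), integral_const_mul,
      integral_fintype_prod_eq_prod (fun i t => (u * b i) ^ t / Gamma (|t| + 1))]
    · congr 2
      exact Finset.prod_congr rfl fun i _ =>
        (setIntegral_congr_fun measurableSet_Ici (hcongr i)).symm
    · refine Eventually.of_forall fun x => mul_nonneg (exp_pos _).le
        (Finset.prod_nonneg fun i _ => div_nonneg (rpow_nonneg (hub i).le _)
          (Gamma_nonneg_of_nonneg (by positivity)))
  rw [h1, lintegral_lintegral_swap, setLIntegral_congr_fun measurableSet_Ioi h2]
  refine Measurable.aemeasurable (ENNReal.measurable_ofReal.comp (Measurable.mul (by fun_prop) ?_))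
  refine Finset.measurable_prod _ fun i _ => ?_
  exact measurable_rpow_div_Gamma_abs.comp
    (f := fun q : (Fin n → ℝ) × ℝ => (q.2 * b i, q.1 i)) (by fun_prop)

end MultinomialDensity

/-! ### The simplex integral -/

section SimplexIntegral

open Real Set
open scoped Pointwise

variable {n : ℕ} {a : Fin n → ℝ}

theorem weightedSimplex_eq_inter (a : Fin n → ℝ) (z : ℝ) :
    weightedSimplex a z = {x | ∑ i, a i * x i ≤ z} ∩ Ici 0 := by
  ext x
  simp only [weightedSimplex, mem_ofPred_eq, mem_inter_iff, mem_Ici, Pi.le_def, Pi.zero_apply,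
    and_comm]

theorem measurableSet_weightedSimplex (a : Fin n → ℝ) (z : ℝ) :
    MeasurableSet (weightedSimplex a z) := by
  rw [weightedSimplex_eq_inter]
  exact (measurableSet_le (by fun_prop) measurable_const).inter measurableSet_Ici

theorem isCompact_weightedSimplex (ha : ∀ i, 0 < a i) (z : ℝ) :
    IsCompact (weightedSimplex a z) := by
  have hsub : weightedSimplex a z ⊆ Icc 0 fun i => z / a i := by
    rintro x ⟨hx, hz⟩
    refine ⟨hx, fun i => ?_⟩
    rw [le_div_iff₀ (ha i), mul_comm]
    exact (Finset.single_le_sum (f := fun i => a i * x i)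
      (fun j _ => mul_nonneg (ha j).le (hx j)) (Finset.mem_univ i)).trans hz
  refine isCompact_Icc.of_isClosed_subset ?_ hsub
  rw [weightedSimplex_eq_inter]
  exact (isClosed_le (by fun_prop) continuous_const).inter isClosed_Ici

theorem integrableOn_multinomialReal (ha : ∀ i, 0 < a i) (z : ℝ) :
    IntegrableOn multinomialReal (weightedSimplex a z) :=
  (continuousOn_multinomialReal.mono fun _ hx => hx.1).integrableOn_compact
    (isCompact_weightedSimplex ha z)

theorem simplexIntegral_nonneg (a : Fin n → ℝ) (z : ℝ) : 0 ≤ simplexIntegral a z :=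
  setIntegral_nonneg (measurableSet_weightedSimplex a z) fun _ hx => multinomialReal_nonneg hx.1

theorem monotone_simplexIntegral (ha : ∀ i, 0 < a i) : Monotone (simplexIntegral a) := by
  intro z z' hz
  refine setIntegral_mono_set (integrableOn_multinomialReal ha z') ?_
    (LE.le.eventuallyLE fun x hx => ⟨hx.1, hx.2.trans hz⟩)
  filter_upwards [ae_restrict_mem (measurableSet_weightedSimplex a z')] with x hx
    using multinomialReal_nonneg hx.1

theorem smul_weightedSimplex (a : Fin n → ℝ) (z : ℝ) {r : ℝ} (hr : 0 < r) :
    r • weightedSimplex a z = weightedSimplex a (r * z) := by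
  ext x
  rw [mem_smul_set_iff_inv_smul_mem₀ hr.ne']
  simp only [weightedSimplex, mem_ofPred_eq, Pi.smul_apply, smul_eq_mul]
  have : ∑ i, a i * (r⁻¹ * x i) = r⁻¹ * ∑ i, a i * x i := by
    rw [Finset.mul_sum]; exact Finset.sum_congr rfl fun i _ => by ring
  rw [this, inv_mul_le_iff₀ hr]
  refine and_congr (forall_congr' fun i => ?_) Iff.rfl
  rw [mul_nonneg_iff_of_pos_left (inv_pos.2 hr)]

theorem prod_exp_neg_rpow (a x : Fin n → ℝ) (c : ℝ) :
    ∏ i, exp (-(c * a i)) ^ x i = exp (-(c * ∑ i, a i * x i)) := by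
  simp_rw [← exp_mul]
  rw [← exp_sum, Finset.mul_sum, ← Finset.sum_neg_distrib]
  congr 1
  exact Finset.sum_congr rfl fun i _ => by ring

/-- `f(z) exp (-z) / z ^ (n + 1)` is nonincreasing: dilate `S(z)` onto `S(r z)` and use the scaling
bound for the multinomial coefficient. -/
theorem simplexIntegral_div_exp_scale (ha : ∀ i, 0 < a i) (hsum : ∑ i, exp (-a i) = 1)
    {r z : ℝ} (hr : 1 ≤ r) :
    simplexIntegral a (r * z) / exp (r * z) ≤ r ^ (n + 1) * (simplexIntegral a z / exp z) := by
  have hr0 : 0 < r := zero_lt_one.trans_le hr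
  have h1 := Measure.setIntegral_comp_smul_of_pos volume
    (multinomialReal : (Fin n → ℝ) → ℝ) (weightedSimplex a z) hr0
  rw [smul_weightedSimplex a z hr0, Module.finrank_fin_fun, smul_eq_mul,
    eq_inv_mul_iff_mul_eq₀ (by positivity)] at h1
  have hpt : ∀ x ∈ weightedSimplex a z,
      multinomialReal (r • x) ≤ r * exp ((r - 1) * z) * multinomialReal x := by
    rintro x ⟨hx, hz⟩
    have h := multinomialReal_mul_prod_rpow_scale (p := fun i => exp (-a i)) (x := x)
      (fun i => exp_pos _) hsum hx hr
    have e1 := prod_exp_neg_rpow a x 1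
    have e2 := prod_exp_neg_rpow a (r • x) 1
    simp only [one_mul, Pi.smul_apply, smul_eq_mul] at e1 e2
    rw [e1, e2, exp_neg, ← div_eq_mul_inv, div_le_iff₀ (exp_pos _)] at h
    have e3 : ∑ i, a i * (r * x i) = r * ∑ i, a i * x i := by
      rw [Finset.mul_sum]; exact Finset.sum_congr rfl fun i _ => by ring
    rw [e3] at h
    have hM := multinomialReal_nonneg (x := x) hx
    calc multinomialReal (r • x)
        ≤ r * (multinomialReal x * exp (-∑ i, a i * x i)) * exp (r * ∑ i, a i * x i) := h
      _ = r * multinomialReal x * exp ((r - 1) * ∑ i, a i * x i) := by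
        rw [show (r - 1) * ∑ i, a i * x i = -∑ i, a i * x i + r * ∑ i, a i * x i by ring, exp_add]
        ring
      _ ≤ r * multinomialReal x * exp ((r - 1) * z) := by
        refine mul_le_mul_of_nonneg_left (exp_le_exp.2 ?_) (by positivity)
        exact mul_le_mul_of_nonneg_left hz (by linarith)
      _ = r * exp ((r - 1) * z) * multinomialReal x := by ring
  have hint : IntegrableOn (fun x => multinomialReal (r • x)) (weightedSimplex a z) := by
    refine ContinuousOn.integrableOn_compact (isCompact_weightedSimplex ha z) ?_
    exact continuousOn_multinomialReal.comp (by fun_prop) fun x hx =>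
      mem_Ici.2 (smul_nonneg hr0.le (show 0 ≤ x from hx.1))
  have h2 := setIntegral_mono_on hint ((integrableOn_multinomialReal ha z).const_mul _)
    (measurableSet_weightedSimplex a z) hpt
  rw [integral_const_mul] at h2
  have h3 : simplexIntegral a (r * z) ≤ r ^ n * (r * exp ((r - 1) * z) * simplexIntegral a z) := by
    rw [simplexIntegral, ← h1]
    exact mul_le_mul_of_nonneg_left h2 (by positivity)
  rw [div_le_iff₀ (exp_pos _)]
  refine h3.trans (le_of_eq ?_)
  rw [show r * z = (r - 1) * z + z by ring, exp_add, pow_succ]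
  field_simp

/-- By Tonelli, integrating `z` out first over `z ≥ ∑ aᵢ xᵢ`, the Laplace transform of
`f(z) exp (-z)` reduces to a one-dimensional integral of Volterra functions. -/
theorem lintegral_laplace_simplexIntegral (ha : ∀ i, 0 < a i) {ε : ℝ} (hε : 0 < ε) :
    ∫⁻ z in Ioi 0, ENNReal.ofReal (exp (-(ε * z)) * (simplexIntegral a z / exp z))
      = ENNReal.ofReal (1 + ε)⁻¹ * ∫⁻ u in Ioi 0,
        ENNReal.ofReal (exp (-u) * ∏ i, volterraNu (u * exp (-((1 + ε) * a i)))) := by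
  have hε1 : 0 < 1 + ε := by linarith
  let A : Set (ℝ × (Fin n → ℝ)) := {q | ∑ i, a i * q.2 i ≤ q.1}
  let E : ℝ × (Fin n → ℝ) → ENNReal :=
    A.indicator fun q => ENNReal.ofReal (exp (-((1 + ε) * q.1)))
  have hE : Measurable E := Measurable.indicator (by fun_prop)
    (measurableSet_le (by fun_prop) (by fun_prop))
  have h1 : ∀ z, ENNReal.ofReal (exp (-(ε * z)) * (simplexIntegral a z / exp z))
      = ∫⁻ x in Ici 0, E (z, x) * ENNReal.ofReal (multinomialReal x) := by
    intro z
    have e : exp (-(ε * z)) * (simplexIntegral a z / exp z)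
        = exp (-((1 + ε) * z)) * simplexIntegral a z := by
      rw [show -((1 + ε) * z) = -(ε * z) + -z by ring, exp_add, exp_neg z]
      ring
    rw [e, ENNReal.ofReal_mul (exp_pos _).le, simplexIntegral,
      ofReal_integral_eq_lintegral_ofReal (integrableOn_multinomialReal ha z) (by
        filter_upwards [ae_restrict_mem (measurableSet_weightedSimplex a z)] with x hx
          using multinomialReal_nonneg hx.1),
      ← lintegral_const_mul' _ _ ENNReal.ofReal_ne_top, weightedSimplex_eq_inter,
      ← Measure.restrict_restrict (measurableSet_le (by fun_prop) measurable_const),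
      ← lintegral_indicator (measurableSet_le (by fun_prop) measurable_const)]
    refine lintegral_congr fun x => ?_
    by_cases hx : ∑ i, a i * x i ≤ z
    · have hx' : (z, x) ∈ A := hx
      rw [indicator_of_mem (show x ∈ {x | ∑ i, a i * x i ≤ z} from hx)]
      simp only [E, indicator_of_mem hx']
    · have hx' : (z, x) ∉ A := hx
      rw [indicator_of_notMem (show x ∉ {x | ∑ i, a i * x i ≤ z} from hx)]
      simp only [E, indicator_of_notMem hx', zero_mul]
  have h2 : ∀ x ∈ Ici (0 : Fin n → ℝ),
      ∫⁻ z in Ici 0, E (z, x) * ENNReal.ofReal (multinomialReal x)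
      = ENNReal.ofReal (1 + ε)⁻¹ *
        ENNReal.ofReal (multinomialReal x * ∏ i, exp (-((1 + ε) * a i)) ^ x i) := by
    intro x hx
    have hx : 0 ≤ x := hx
    set t := ∑ i, a i * x i with ht
    have ht0 : 0 ≤ t := Finset.sum_nonneg fun i _ => mul_nonneg (ha i).le (hx i)
    have e : ∀ z, E (z, x) = (Ici t).indicator
        (fun z => ENNReal.ofReal (exp (-((1 + ε) * z)))) z := by
      intro z
      by_cases hz : t ≤ z
      · have hz' : (z, x) ∈ A := hz
        rw [indicator_of_mem (mem_Ici.2 hz)]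
        simp only [E, indicator_of_mem hz']
      · have hz' : (z, x) ∉ A := hz
        rw [indicator_of_notMem (by simpa using hz)]
        simp only [E, indicator_of_notMem hz']
    have hint := integrableOn_exp_mul_Ioi (a := -(1 + ε)) (by linarith) t
    have hval := integral_exp_mul_Ioi (a := -(1 + ε)) (by linarith) t
    simp only [neg_mul, neg_div_neg_eq] at hint hval
    rw [lintegral_mul_const' _ _ ENNReal.ofReal_ne_top]
    simp_rw [e]
    rw [lintegral_indicator measurableSet_Ici, Measure.restrict_restrict measurableSet_Ici,
      inter_eq_left.2 (Ici_subset_Ici.2 ht0), setLIntegral_congr Ioi_ae_eq_Ici.symm,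
      ← ofReal_integral_eq_lintegral_ofReal hint (Eventually.of_forall fun z => (exp_pos _).le),
      hval, prod_exp_neg_rpow, ← ENNReal.ofReal_mul (by positivity),
      ← ENNReal.ofReal_mul (by positivity), ← ht]
    congr 1
    field_simp
  rw [← lintegral_multinomialReal_mul_prod_rpow fun i => exp_pos _,
    ← lintegral_const_mul' _ _ ENNReal.ofReal_ne_top,
    ← setLIntegral_congr_fun measurableSet_Ici h2, setLIntegral_congr Ioi_ae_eq_Ici]
  simp_rw [h1]
  refine lintegral_lintegral_swap (hE.aemeasurable.mul ?_)
  exact (continuousOn_multinomialReal.aemeasurable measurableSet_Ici).ennreal_ofReal.comp_snd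

/-- Isolates the bounded factors `exp (-y) * ν y`, at the cost of changing the exponential rate
from `1` to `1 - ∑ bᵢ`. -/
theorem exp_neg_mul_prod_volterraNu (b : Fin n → ℝ) (u : ℝ) :
    exp (-u) * ∏ i, volterraNu (u * b i)
      = exp (-((1 - ∑ i, b i) * u)) * ∏ i, exp (-(u * b i)) * volterraNu (u * b i) := by
  rw [Finset.prod_mul_distrib, ← exp_sum, Finset.sum_neg_distrib, ← Finset.mul_sum, ← mul_assoc,
    ← exp_add]
  congr 2
  ring

theorem integrableOn_exp_neg_mul_prod_volterraNu {b : Fin n → ℝ} (hb : ∀ i, 0 < b i)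
    (hb1 : ∑ i, b i < 1) :
    IntegrableOn (fun u => exp (-u) * ∏ i, volterraNu (u * b i)) (Ioi 0) := by
  obtain ⟨C, hC⟩ := exists_bound_exp_neg_mul_volterraNu
  refine Integrable.mono' (integrableOn_exp_neg_mul_const (C ^ n) (1 - ∑ i, b i) (by linarith))
    (Measurable.aestronglyMeasurable ?_) ?_
  · refine Measurable.mul (by fun_prop) (Finset.measurable_prod _ fun i _ => ?_)
    exact measurable_volterraNu.comp (by fun_prop)
  · filter_upwards [ae_restrict_mem measurableSet_Ioi] with u hu
    have hν : ∀ i, 0 ≤ volterraNu (u * b i) := fun i => volterraNu_nonneg (mul_pos hu (hb i))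
    rw [norm_of_nonneg (mul_nonneg (exp_pos _).le (Finset.prod_nonneg fun i _ => hν i)),
      exp_neg_mul_prod_volterraNu]
    refine mul_le_mul_of_nonneg_left ?_ (exp_pos _).le
    refine (Finset.prod_le_prod (fun i _ => mul_nonneg (exp_pos _).le (hν i))
      fun i _ => hC _ (mul_pos hu (hb i))).trans (by simp)

/-- The substitution `v = (1 - ∑ bᵢ) u`, which exhibits the blow-up as `∑ bᵢ → 1`. -/
theorem integral_exp_neg_mul_prod_volterraNu (b : Fin n → ℝ) (hb1 : ∑ i, b i < 1) :
    ∫ u in Ioi 0, exp (-u) * ∏ i, volterraNu (u * b i)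
      = (1 - ∑ i, b i)⁻¹ * ∫ v in Ioi 0, exp (-v) * ∏ i,
        exp (-(v * (b i / (1 - ∑ i, b i)))) * volterraNu (v * (b i / (1 - ∑ i, b i))) := by
  have hc : 0 < 1 - ∑ i, b i := by linarith
  simp_rw [exp_neg_mul_prod_volterraNu b]
  have h := integral_comp_mul_left_Ioi (fun v => exp (-v) * ∏ i,
    exp (-(v * (b i / (1 - ∑ i, b i)))) * volterraNu (v * (b i / (1 - ∑ i, b i)))) 0 hc
  rw [mul_zero, smul_eq_mul] at h
  rw [← h]
  have e : ∀ (u : ℝ) i, (1 - ∑ i, b i) * u * (b i / (1 - ∑ i, b i)) = u * b i := fun u i => by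
    field_simp
  simp_rw [e]

theorem tendsto_integral_prod_volterraNu {l : Filter ℝ} [l.IsCountablyGenerated]
    {β : ℝ → Fin n → ℝ} (hpos : ∀ᶠ ε in l, ∀ i, 0 < β ε i)
    (hβ : ∀ i, Tendsto (fun ε => β ε i) l atTop) :
    Tendsto (fun ε => ∫ v in Ioi 0, exp (-v) * ∏ i,
      exp (-(v * β ε i)) * volterraNu (v * β ε i)) l (𝓝 1) := by
  obtain ⟨C, hC⟩ := exists_bound_exp_neg_mul_volterraNu
  have h1 : (1 : ℝ) = ∫ v in Ioi (0 : ℝ), exp (-v) * ∏ _i : Fin n, (1 : ℝ) := by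
    simp only [Finset.prod_const_one, mul_one, integral_exp_neg_Ioi_zero]
  rw [h1]
  refine tendsto_integral_filter_of_dominated_convergence (fun v => exp (-(1 * v)) * C ^ n)
    (Eventually.of_forall fun ε => Measurable.aestronglyMeasurable ?_) ?_
    (integrableOn_exp_neg_mul_const (C ^ n) 1 one_pos) ?_
  · refine Measurable.mul (by fun_prop) (Finset.measurable_prod _ fun i _ => ?_)
    exact Measurable.mul (by fun_prop) (measurable_volterraNu.comp (by fun_prop))
  · filter_upwards [hpos] with ε hε
    filter_upwards [ae_restrict_mem measurableSet_Ioi] with v hv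
    have hν : ∀ i, 0 ≤ exp (-(v * β ε i)) * volterraNu (v * β ε i) := fun i =>
      mul_nonneg (exp_pos _).le (volterraNu_nonneg (mul_pos hv (hε i)))
    rw [norm_of_nonneg (mul_nonneg (exp_pos _).le (Finset.prod_nonneg fun i _ => hν i)), one_mul]
    refine mul_le_mul_of_nonneg_left ?_ (exp_pos _).le
    exact (Finset.prod_le_prod (fun i _ => hν i)
      fun i _ => hC _ (mul_pos hv (hε i))).trans (by simp)
  · filter_upwards [ae_restrict_mem measurableSet_Ioi] with v hv
    refine tendsto_const_nhds.mul (tendsto_finsetProd _ fun i _ => ?_)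
    exact tendsto_exp_neg_mul_volterraNu.comp ((hβ i).const_mul_atTop hv)

theorem sum_exp_neg_lt_one (ha : ∀ i, 0 < a i) (hsum : ∑ i, exp (-a i) = 1) {ε : ℝ}
    (hε : 0 < ε) : ∑ i, exp (-((1 + ε) * a i)) < 1 := by
  have hne : (Finset.univ : Finset (Fin n)).Nonempty := by
    by_contra h
    rw [Finset.not_nonempty_iff_eq_empty] at h
    simp [h] at hsum
  rw [← hsum]
  exact Finset.sum_lt_sum_of_nonempty hne fun i _ => exp_lt_exp.2 (by nlinarith [ha i])

theorem tendsto_one_sub_sum_exp_neg_div (hsum : ∑ i, exp (-a i) = 1) :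
    Tendsto (fun ε => ε⁻¹ * (1 - ∑ i, exp (-((1 + ε) * a i)))) (𝓝[>] 0)
      (𝓝 (∑ i, a i * exp (-a i))) := by
  have h : HasDerivAt (fun ε : ℝ => 1 - ∑ i, exp (-((1 + ε) * a i)))
      (-∑ i, exp (-((1 + 0) * a i)) * -(1 * a i)) 0 := by
    refine HasDerivAt.const_sub _ (HasDerivAt.fun_sum fun i _ => ?_)
    exact ((((hasDerivAt_id (0 : ℝ)).const_add 1).mul_const (a i)).neg).exp
  have := h.tendsto_slope_zero_right
  simpa [hsum, mul_comm] using this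

theorem integrableOn_laplace_simplexIntegral (ha : ∀ i, 0 < a i) (hsum : ∑ i, exp (-a i) = 1)
    {ε : ℝ} (hε : 0 < ε) :
    IntegrableOn (fun z => exp (-(ε * z)) * (simplexIntegral a z / exp z)) (Ioi 0) := by
  refine ⟨(Measurable.mul (by fun_prop)
    ((monotone_simplexIntegral ha).measurable.div (by fun_prop))).aestronglyMeasurable, ?_⟩
  rw [hasFiniteIntegral_iff_ofReal, lintegral_laplace_simplexIntegral ha hε]
  · refine ENNReal.mul_lt_top ENNReal.ofReal_lt_top ?_
    exact (integrableOn_exp_neg_mul_prod_volterraNu (fun i => exp_pos _)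
      (sum_exp_neg_lt_one ha hsum hε)).lintegral_lt_top
  · refine Eventually.of_forall fun z => ?_
    have := simplexIntegral_nonneg a z
    simp only [Pi.zero_apply]
    positivity

theorem integral_laplace_simplexIntegral (ha : ∀ i, 0 < a i) (hsum : ∑ i, exp (-a i) = 1)
    {ε : ℝ} (hε : 0 < ε) :
    ∫ z in Ioi 0, exp (-(ε * z)) * (simplexIntegral a z / exp z)
      = (1 + ε)⁻¹ * ∫ u in Ioi 0,
        exp (-u) * ∏ i, volterraNu (u * exp (-((1 + ε) * a i))) := by
  have hi := integrableOn_exp_neg_mul_prod_volterraNu (b := fun i => exp (-((1 + ε) * a i)))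
      (fun i => exp_pos _) (sum_exp_neg_lt_one ha hsum hε)
  rw [integral_eq_lintegral_of_nonneg_ae, lintegral_laplace_simplexIntegral ha hε,
    ENNReal.toReal_mul, ENNReal.toReal_ofReal (by positivity),
    integral_eq_lintegral_of_nonneg_ae _ hi.aestronglyMeasurable]
  · filter_upwards [ae_restrict_mem measurableSet_Ioi] with u hu
    exact mul_nonneg (exp_pos _).le (Finset.prod_nonneg fun i _ =>
      volterraNu_nonneg (mul_pos hu (exp_pos _)))
  · refine Eventually.of_forall fun z => ?_
    have := simplexIntegral_nonneg a z
    simp only [Pi.zero_apply]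
    positivity
  · exact (integrableOn_laplace_simplexIntegral ha hsum hε).aestronglyMeasurable

/-- With `bᵢ = exp (-(1 + ε) aᵢ)`, the transform is `∼ 1 / (1 - ∑ bᵢ)`, and `(1 - ∑ bᵢ) / ε` tends
to the entropy. -/
theorem tendsto_laplace_simplexIntegral (ha : ∀ i, 0 < a i) (hsum : ∑ i, exp (-a i) = 1) :
    Tendsto (fun ε => ε * ∫ z in Ioi 0, exp (-(ε * z)) * (simplexIntegral a z / exp z))
      (𝓝[>] 0) (𝓝 (∑ i, a i * exp (-a i))⁻¹) := by
  set b : ℝ → Fin n → ℝ := fun ε i => exp (-((1 + ε) * a i)) with hb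
  have hne : (Finset.univ : Finset (Fin n)).Nonempty := by
    by_contra h
    rw [Finset.not_nonempty_iff_eq_empty] at h
    simp [h] at hsum
  have hH : 0 < ∑ i, a i * exp (-a i) :=
    Finset.sum_pos (fun i _ => mul_pos (ha i) (exp_pos _)) hne
  have hc : ∀ ε : ℝ, 0 < ε → 0 < 1 - ∑ i, b ε i := fun ε hε =>
    sub_pos.2 (sum_exp_neg_lt_one ha hsum hε)
  have hbt : ∀ i, Tendsto (fun ε => b ε i) (𝓝[>] 0) (𝓝 (exp (-a i))) := by
    intro i
    have : ContinuousAt (fun ε : ℝ => b ε i) 0 := by simp only [hb]; fun_prop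
    simpa [ContinuousAt, hb] using this.mono_left nhdsWithin_le_nhds
  have hc0 : Tendsto (fun ε => 1 - ∑ i, b ε i) (𝓝[>] 0) (𝓝[>] 0) := by
    refine tendsto_nhdsWithin_iff.2 ⟨?_, ?_⟩
    · have := (tendsto_finsetSum Finset.univ fun i _ => hbt i).const_sub 1
      rwa [hsum, sub_self] at this
    · filter_upwards [self_mem_nhdsWithin] with ε hε using hc ε hε
  have hβ : ∀ i, Tendsto (fun ε => b ε i / (1 - ∑ i, b ε i)) (𝓝[>] 0) atTop := fun i =>
    (hbt i).pos_mul_atTop (exp_pos _) (tendsto_inv_nhdsGT_zero.comp hc0)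
  have h1 := tendsto_integral_prod_volterraNu (β := fun ε i => b ε i / (1 - ∑ i, b ε i)) (by
    filter_upwards [self_mem_nhdsWithin] with ε hε i using div_pos (exp_pos _) (hc ε hε)) hβ
  have h2 : Tendsto (fun ε : ℝ => (1 + ε)⁻¹) (𝓝[>] 0) (𝓝 1) := by
    have : ContinuousAt (fun ε : ℝ => (1 + ε)⁻¹) 0 :=
      ContinuousAt.inv₀ (by fun_prop) (by norm_num)
    simpa [ContinuousAt] using this.mono_left nhdsWithin_le_nhds
  have h3 := ((tendsto_one_sub_sum_exp_neg_div hsum).inv₀ hH.ne').mul (h2.mul h1)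
  rw [mul_one, mul_one] at h3
  refine h3.congr' ?_
  filter_upwards [self_mem_nhdsWithin] with ε hε
  rw [integral_laplace_simplexIntegral ha hsum hε,
    integral_exp_neg_mul_prod_volterraNu (b ε) (sum_exp_neg_lt_one ha hsum hε)]
  simp only [hb, mul_inv, inv_inv]
  ring

end SimplexIntegral

theorem theorem4 (n : ℕ) (a p : Fin n → ℝ) (ha : ∀ i, 0 < a i)
    (hp : ∀ i, p i = Real.exp (-a i)) (hsum : ∑ i, p i = 1) :
    Tendsto (fun z : ℝ => simplexIntegral a z / Real.exp z) atTop
      (𝓝 (∑ i, a i * p i)⁻¹) := by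
  obtain rfl : p = fun i => Real.exp (-a i) := funext hp
  exact tendsto_of_tendsto_laplace (K := n + 1)
    (fun z _ => div_nonneg (simplexIntegral_nonneg a z) (Real.exp_pos z).le)
    (fun r z hr _ => simplexIntegral_div_exp_scale ha hsum hr)
    (fun ε hε => integrableOn_laplace_simplexIntegral ha hsum hε)
    (tendsto_laplace_simplexIntegral ha hsum)
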